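/- Let $\mathcal M$ be a separable type $\mathrm{II}_1$ factor with faithful normal tracial state $\tau$, acting by left multiplication on the Hilbert space $L^2(\mathcal M)$, the completion of $\mathcal M$ for $\langle x,y\rangle=\tau(y^*x)$; for $b\in\mathcal M$ let $\zeta\mapsto\zeta b$ be the bounded operator on $L^2(\mathcal M)$ extending right multiplication. Let $A\subset\mathcal M$ be a masa, let $N(A)=\{u\in\mathcal U(\mathcal M): uAu^*=A\}$, let $N(A)''$ be the von Neumann algebra it generates, and let $L^2(N(A)'')$ be the closure of $N(A)''$ in $L^2(\mathcal M)$. Let $X$ be a compact Hausdorff space such that $C(X)\subset A$ is a unital, norm separable $C^*$-subalgebra that is dense in $A$ in the weak operator topology, and let $\nu$ be the tracial measure, i.e. the Borel probability measure on $X$ with $\tau(f)=\int_X f\,d\nu$ for $f\in C(X)$. Let $0\neq\zeta\in L^2(N(A)'')$. Then there is a unique finite positive Borel measure $\eta_\zeta$ on $X\times X$ with $$\langle a\zeta b,\zeta\rangle=\int_{X\times X}a(t)\,b(s)\,d\eta_\zeta(t,s)\qquad (a,b\in C(X)).$$ For each of the two coordinate projections $T=\pi_1,\pi_2:X\times X\to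 X$, the measure $\eta_\zeta$ has a $(T,\nu)$-disintegration, that is, a family $(\lambda_t)_{t\in X}$ of measures on $X\times X$ such that for $\nu$-almost every $t$ the measure $\lambda_t$ is $\sigma$-finite and satisfies $\lambda_t(\{T\ne t\})=0$, and such that for every Borel function $f\ge 0$ on $X\times X$ the function $t\mapsto\int f\,d\lambda_t$ is $\nu$-measurable (measurable for the completion of $\nu$) and $\int f\,d\eta_\zeta=\int_X\big(\int f\,d\lambda_t\big)\,d\nu(t)$. Moreover, for every such disintegration, $\lambda_t$ is completely atomic for $\nu$-almost every $t$, i.e. $\lambda_t(\{z\in X\times X:\lambda_t(\{z\})=0\})=0$ (the zero measure counts as completely atomic). -/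

import Mathlib

open MeasureTheory TopologicalSpace
open scoped ComplexOrder InnerProductSpace ENNReal

universe u v

namespace MasaBimodule

/-! ### Separable type II₁ factors and their trace -/

/-- `M` is a separable von Neumann algebra: a C⋆-algebra that is the dual of a separable
Banach space. -/
def IsSeparableVonNeumannAlgebra (M : Type u) [CStarAlgebra M] : Prop :=
  ∃ (P : Type u) (_ : NormedAddCommGroup P) (_ : NormedSpace ℂ P) (_ : CompleteSpace P),
    SeparableSpace P ∧ Nonempty (StrongDual ℂ P ≃ₗᵢ⋆[ℂ] M)

/-- `M` is a separable factor of type II₁. -/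
structure IsSeparableTypeII1Factor (M : Type u) [CStarAlgebra M] : Prop where
  separable : IsSeparableVonNeumannAlgebra M
  nontrivial : Nontrivial M
  /-- The centre consists of the scalars. -/
  factor : Subalgebra.center ℂ M = ⊥
  /-- The unit is a finite projection. -/
  finite : ∀ v : M, star v * v = 1 → v * star v = 1
  /-- There is no nonzero abelian projection. -/
  continuous_type : ∀ p : M, IsStarProjection p →
    (∀ x y : M, (p * x * p) * (p * y * p) = (p * y * p) * (p * x * p)) → p = 0

section Trace

variable {M : Type u} [CStarAlgebra M] [PartialOrder M] [StarOrderedRing M]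

/-- `τ` is a faithful, normal, tracial state. -/
structure IsFaithfulNormalTracialState (τ : M →ₚ[ℂ] ℂ) : Prop where
  map_one : τ 1 = 1
  tracial : ∀ x y : M, τ (x * y) = τ (y * x)
  faithful : ∀ x : M, τ (star x * x) = 0 → x = 0
  /-- `τ` preserves suprema of upward directed sets of self-adjoint elements. -/
  normal : ∀ (S : Set M) (x : M), S.Nonempty → DirectedOn (· ≤ ·) S →
    (∀ s ∈ S, IsSelfAdjoint s) → IsLUB S x →
    IsLUB ((fun s => (τ s).re) '' S) (τ x).re

/-! ### The standard Hilbert space as a bimodule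

`τ.GNS` is the completion of `M` for the inner product `⟪x, y⟫ = τ (x⋆ y)`, i.e. `L²(M, τ)`,
and `τ.gnsStarAlgHom` is the action of `M` on it by left multiplication. -/

/-- The canonical map `x ↦ x̂` of `M` into `L²(M, τ)`. -/
noncomputable def hat (τ : M →ₚ[ℂ] ℂ) : M →ₗ[ℂ] τ.GNS where
  toFun x := ((τ.toPreGNS x : τ.PreGNS) : τ.GNS)
  map_add' x y := by rw [map_add, UniformSpace.Completion.coe_add]
  map_smul' c x := by
    rw [map_smul, UniformSpace.Completion.coe_smul, RingHom.id_apply]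

/-- The bounded operator `ζ ↦ ζ b` of right multiplication by `b ∈ M` on `L²(M, τ)`: the
continuous extension of `x̂ ↦ (x b)^` (see `rightMul_hat`). -/
noncomputable def rightMul (τ : M →ₚ[ℂ] ℂ) (b : M) : τ.GNS →L[ℂ] τ.GNS :=
  LinearMap.extendOfNorm ((hat τ).comp (LinearMap.mulRight ℂ b)) (hat τ)

theorem denseRange_hat (τ : M →ₚ[ℂ] ℂ) : DenseRange (hat τ) := by
  have h : DenseRange ((↑) : τ.PreGNS → τ.GNS) := UniformSpace.Completion.denseRange_coe
  exact h

theorem inner_hat (τ : M →ₚ[ℂ] ℂ) (x y : M) : ⟪hat τ x, hat τ y⟫_ℂ = τ (star x * y) := by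
  have h := UniformSpace.Completion.inner_coe (𝕜 := ℂ) (τ.toPreGNS x) (τ.toPreGNS y)
  exact h.trans (τ.preGNS_inner_def _ _)

theorem gnsStarAlgHom_hat (τ : M →ₚ[ℂ] ℂ) (a x : M) :
    τ.gnsStarAlgHom a (hat τ x) = hat τ (a * x) := by
  exact τ.gnsNonUnitalStarAlgHom_apply_coe

theorem norm_hat_sq (τ : M →ₚ[ℂ] ℂ) (x : M) : ((‖hat τ x‖ ^ 2 : ℝ) : ℂ) = τ (star x * x) := by
  have := inner_self_eq_norm_sq_to_K (𝕜 := ℂ) (hat τ x)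
  rw [inner_hat] at this
  rw [this]
  push_cast
  rfl

theorem norm_hat_mul_le {τ : M →ₚ[ℂ] ℂ} (hτ : IsFaithfulNormalTracialState τ) (x b : M) :
    ‖hat τ (x * b)‖ ≤ ‖b‖ * ‖hat τ x‖ := by
  have h1 : ∀ y : M, ‖hat τ (star y)‖ = ‖hat τ y‖ := by
    intro y
    have : ((‖hat τ (star y)‖ ^ 2 : ℝ) : ℂ) = ((‖hat τ y‖ ^ 2 : ℝ) : ℂ) := by
      rw [norm_hat_sq, norm_hat_sq, hτ.tracial, star_star]
    have h2 : ‖hat τ (star y)‖ ^ 2 = ‖hat τ y‖ ^ 2 := by exact_mod_cast this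
    exact (sq_eq_sq₀ (norm_nonneg _) (norm_nonneg _)).1 h2
  have h3 : ‖τ.leftMulMapPreGNS (star b) (τ.toPreGNS (star x))‖
      ≤ ‖star b‖ * ‖τ.toPreGNS (star x)‖ :=
    ContinuousLinearMap.le_of_opNorm_le _
      (LinearMap.mkContinuous_norm_le _ (norm_nonneg _) _) _
  have h4 : ‖hat τ (star b * star x)‖ ≤ ‖star b‖ * ‖hat τ (star x)‖ := by
    have e : ∀ y : M, ‖hat τ y‖ = ‖τ.toPreGNS y‖ := fun y =>
      UniformSpace.Completion.norm_coe _
    rw [e, e]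
    exact h3
  rwa [← star_mul, h1, h1, norm_star] at h4

theorem rightMul_hat {τ : M →ₚ[ℂ] ℂ} (hτ : IsFaithfulNormalTracialState τ) (b x : M) :
    rightMul τ b (hat τ x) = hat τ (x * b) :=
  LinearMap.extendOfNorm_eq (denseRange_hat τ) ⟨‖b‖, fun y => norm_hat_mul_le hτ y b⟩ x

/-! ### Masas, normalisers, dense C⋆-subalgebras -/

/-- `A` is a masa: a maximal abelian self-adjoint subalgebra of `M`. -/
def IsMasa (A : StarSubalgebra ℂ M) : Prop :=
  Maximal (fun B : StarSubalgebra ℂ M => ∀ x ∈ B, ∀ y ∈ B, x * y = y * x) A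

/-- The group `N(A)` of unitaries `u` of `M` with `u A u⋆ = A`. -/
def normalizer (A : StarSubalgebra ℂ M) : Set M :=
  {u | u ∈ unitary M ∧ (fun a => u * a * star u) '' (A : Set M) = A}

/-- The von Neumann algebra `S''` generated by a self-adjoint set `S ⊆ M`; the commutants are
taken in the bounded operators on `L²(M, τ)`, on which `M` acts by left multiplication. -/
def bicommutant (τ : M →ₚ[ℂ] ℂ) (S : Set M) : Set M :=
  {x | τ.gnsStarAlgHom x ∈ Set.centralizer (Set.centralizer (τ.gnsStarAlgHom '' S))}

/-- For a von Neumann subalgebra `N ⊆ M`, the subspace `L²(N)` of `L²(M, τ)`. -/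
def L2 (τ : M →ₚ[ℂ] ℂ) (N : Set M) : Set τ.GNS :=
  closure (hat τ '' N)

/-- `ι` identifies `C(X)` with a unital C⋆-subalgebra of `A` that is dense in `A` for the weak
operator topology of the bounded operators on `L²(M, τ)`. -/
structure IsWOTDenseIn {X : Type v} [TopologicalSpace X] [CompactSpace X] (τ : M →ₚ[ℂ] ℂ)
    (A : StarSubalgebra ℂ M) (ι : C(X, ℂ) →⋆ₐ[ℂ] M) : Prop where
  injective : Function.Injective ι
  mem : ∀ f, ι f ∈ A
  dense : ∀ a ∈ A, ContinuousLinearMapWOT.ofCLM (τ.gnsStarAlgHom a) ∈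
    closure (Set.range fun f : C(X, ℂ) =>
      ContinuousLinearMapWOT.ofCLM (τ.gnsStarAlgHom (ι f)))

/-! ### The measures -/

/-- `ν` is the tracial measure on `X`: the Borel probability measure given by `τ` on `C(X)`. -/
structure IsTracialMeasure {X : Type v} [TopologicalSpace X] [CompactSpace X]
    [MeasurableSpace X] (τ : M →ₚ[ℂ] ℂ) (ι : C(X, ℂ) →⋆ₐ[ℂ] M) (ν : Measure X) : Prop where
  isProbabilityMeasure : IsProbabilityMeasure ν
  integral_eq : ∀ f : C(X, ℂ), ∫ t, f t ∂ν = τ (ι f)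

/-- `η` is the measure `η_ζ` on `X × X` representing `a ⊗ b ↦ ⟨a ζ b, ζ⟩`. (In Mathlib inner
products are linear in the second variable.) -/
structure IsBimoduleMeasure {X : Type v} [TopologicalSpace X] [CompactSpace X]
    [MeasurableSpace X] (τ : M →ₚ[ℂ] ℂ) (ι : C(X, ℂ) →⋆ₐ[ℂ] M) (ζ : τ.GNS)
    (η : Measure (X × X)) : Prop where
  isFiniteMeasure : IsFiniteMeasure η
  integral_eq : ∀ a b : C(X, ℂ),
    ∫ p, a p.1 * b p.2 ∂η = ⟪ζ, τ.gnsStarAlgHom (ι a) (rightMul τ (ι b) ζ)⟫_ℂ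

end Trace

/-- `lam` is a `(T, μ)`-disintegration `{lam_t}` of the measure `η`. -/
structure IsDisintegration {Z Y : Type*} [MeasurableSpace Z] [MeasurableSpace Y]
    (T : Z → Y) (η : Measure Z) (μ : Measure Y) (lam : Y → Measure Z) : Prop where
  sigmaFinite : ∀ᵐ t ∂μ, SigmaFinite (lam t)
  concentrated : ∀ᵐ t ∂μ, lam t {z | T z ≠ t} = 0
  aemeasurable : ∀ f : Z → ℝ≥0∞, Measurable f → AEMeasurable (fun t => ∫⁻ z, f z ∂lam t) μ
  lintegral_eq : ∀ f : Z → ℝ≥0∞, Measurable f →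
    ∫⁻ z, f z ∂η = ∫⁻ t, ∫⁻ z, f z ∂lam t ∂μ

/-- `μ` is completely atomic: it is carried by the set of its atoms. -/
def CompletelyAtomic {Z : Type*} [MeasurableSpace Z] (μ : Measure Z) : Prop :=
  μ {z | μ {z} = 0} = 0

end MasaBimodule

/-!
The idea is that a normaliser `u` of the masa `A` gives a measure `η_u` carried by the graph of a
transformation of `X`, and that this survives, in the form of countably many points in each fibre,
in the closed linear span of the normalisers.

* The commuting left and right actions of `C(X)` on `L²(M)` combine, by Gelfand duality, into a
  representation `Φ` of `C(X × X)` (`exists_starAlgHom_prod_of_commute`,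
  `exists_isBimoduleRep`), and `η_ξ` is the Riesz measure of `F ↦ ⟨ξ, Φ(F) ξ⟩`
  (`spectralMeasure`). Its values on products `a ⊗ b` determine it
  (`IsBimoduleMeasure.unique`).
* By the parallelogram law, `η_{ξ + ξ'} ≤ 2 (η_ξ + η_{ξ'})`; as `η_ξ` has mass `‖ξ‖²`, the vectors
  `ξ` with `η_ξ(E) = 0` form a closed subspace, for every set `E` (`isClosed_nullSubmodule`).
* The projection onto the closed span of `N(A)` commutes with `N(A)` and hence with `N(A)''`, so
  `L²(N(A)'')` lies in that span (`L2_bicommutant_normalizer_subset`).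
* For a unitary `u` both marginals of `η_u` are `ν`. If `u` normalises `A` and `a ∈ C(X)`, then
  `u⋆ a u ∈ A` is a `‖·‖₂`-limit of functions `b ∈ C(X)`, and
  `∫ |a(t) - b(s)|² dη_u(t, s) = ‖a u - u b‖₂² = ‖u⋆ a u - b‖₂²`. So `a(t)` is a function of `s`
  almost everywhere; letting `a` run through a dense sequence of `C(X)`, `t` is a function of `s`,
  and symmetrically `s` is a function of `t` (`exists_conull_subsingleton_fibres`).
* A vector `ζ` in the closed span of the normalisers lies in that of countably many of them. By the
  closed subspace property the marginals of `η_ζ` are absolutely continuous with respect to `ν`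
  (`map_spectralMeasure_absolutelyContinuous`), and `η_ζ` is carried by a set with countable fibres
  over both coordinates (`exists_conull_countable_fibres`). The first gives the disintegrations
  (`exists_isDisintegration`), the second makes almost every fibre measure of any disintegration
  live on a countable set (`IsDisintegration.ae_completelyAtomic`).
-/

namespace MasaBimodule

/-! ### Joint functional calculus of commuting representations -/

/-- Commuting representations of `C(X)` and `C(Y)` in a C⋆-algebra extend to a representation of
`C(X × Y)`. The closed subalgebra they generate is commutative, hence is `C(Ω)` with `Ω` its
character space, and restricting characters gives a continuous map `Ω → X × Y`. -/
theorem exists_starAlgHom_prod_of_commute {X Y B : Type*} [TopologicalSpace X] [CompactSpace X]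
    [T2Space X] [TopologicalSpace Y] [CompactSpace Y] [T2Space Y] [CStarAlgebra B]
    (L : C(X, ℂ) →⋆ₐ[ℂ] B) (R : C(Y, ℂ) →⋆ₐ[ℂ] B) (hLR : ∀ f g, Commute (L f) (R g)) :
    ∃ Φ : C(X × Y, ℂ) →⋆ₐ[ℂ] B, (∀ f : C(X, ℂ), Φ (f.comp .fst) = L f) ∧
      ∀ g : C(Y, ℂ), Φ (g.comp .snd) = R g := by
  set s : Set B := Set.range L ∪ Set.range R with hs
  have hcomm : ∀ a ∈ s, ∀ b ∈ s, a * b = b * a := by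
    rintro _ (⟨f, rfl⟩ | ⟨f, rfl⟩) _ (⟨g, rfl⟩ | ⟨g, rfl⟩)
    · rw [← map_mul, mul_comm, map_mul]
    · exact hLR f g
    · exact (hLR g f).symm
    · rw [← map_mul, mul_comm, map_mul]
  have hstar : ∀ b ∈ s, star b ∈ s := by
    rintro _ (⟨g, rfl⟩ | ⟨g, rfl⟩)
    · exact Or.inl ⟨star g, map_star L g⟩
    · exact Or.inr ⟨star g, map_star R g⟩
  have hadj : IsMulCommutative (StarAlgebra.adjoin ℂ s) :=
    StarAlgebra.isMulCommutative_adjoin ℂ hcomm fun a ha b hb => hcomm a ha _ (hstar b hb)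
  set S := (StarAlgebra.adjoin ℂ s).topologicalClosure with hS
  have hmem : ∀ b ∈ s, b ∈ S := fun b hb =>
    StarSubalgebra.le_topologicalClosure _ (StarAlgebra.subset_adjoin ℂ s hb)
  have hclosed : IsClosed (S : Set B) := StarSubalgebra.isClosed_topologicalClosure _
  let _ : CStarAlgebra S := StarSubalgebra.cstarAlgebra S (h_closed := hclosed)
  let _ : CommCStarAlgebra S :=
    { (inferInstance : CStarAlgebra S) with
      mul_comm := (StarSubalgebra.commRingTopologicalClosure (StarAlgebra.adjoin ℂ s)
        fun x y => hadj.is_comm.comm x y).mul_comm }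
  let L' : C(X, ℂ) →⋆ₐ[ℂ] S := L.codRestrict S fun f => hmem _ (Or.inl ⟨f, rfl⟩)
  let R' : C(Y, ℂ) →⋆ₐ[ℂ] S := R.codRestrict S fun f => hmem _ (Or.inr ⟨f, rfl⟩)
  let p : C(WeakDual.characterSpace ℂ S, X) :=
    ((WeakDual.CharacterSpace.homeoEval X ℂ).symm : C(_, X)).comp
      (WeakDual.CharacterSpace.compContinuousMap L')
  let q : C(WeakDual.characterSpace ℂ S, Y) :=
    ((WeakDual.CharacterSpace.homeoEval Y ℂ).symm : C(_, Y)).comp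
      (WeakDual.CharacterSpace.compContinuousMap R')
  have hp : ∀ (f : C(X, ℂ)) χ, f (p χ) = χ (L' f) := by
    intro f χ
    have : WeakDual.CharacterSpace.homeoEval X ℂ (p χ) =
        WeakDual.CharacterSpace.compContinuousMap L' χ :=
      (WeakDual.CharacterSpace.homeoEval X ℂ).apply_symm_apply _
    exact congrArg (fun ψ : WeakDual.characterSpace ℂ C(X, ℂ) => ψ f) this
  have hq : ∀ (f : C(Y, ℂ)) χ, f (q χ) = χ (R' f) := by
    intro f χ
    have : WeakDual.CharacterSpace.homeoEval Y ℂ (q χ) =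
        WeakDual.CharacterSpace.compContinuousMap R' χ :=
      (WeakDual.CharacterSpace.homeoEval Y ℂ).apply_symm_apply _
    exact congrArg (fun ψ : WeakDual.characterSpace ℂ C(Y, ℂ) => ψ f) this
  let G := gelfandStarTransform S
  refine ⟨S.subtype.comp ((G.symm : _ →⋆ₐ[ℂ] S).comp
    ((p.prodMk q).compStarAlgHom' ℂ ℂ)), fun f => ?_, fun g => ?_⟩
  · have : (p.prodMk q).compStarAlgHom' ℂ ℂ (f.comp .fst) = G (L' f) := by
      ext χ
      exact hp f χ
    simp only [StarAlgHom.comp_apply, this]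
    exact congrArg Subtype.val (G.symm_apply_apply (L' f))
  · have : (p.prodMk q).compStarAlgHom' ℂ ℂ (g.comp .snd) = G (R' g) := by
      ext χ
      exact hq g χ
    simp only [StarAlgHom.comp_apply, this]
    exact congrArg Subtype.val (G.symm_apply_apply (R' g))

/-! ### Spectral measures of a representation of `C(Z)` -/

section SpectralMeasure

variable {Z H : Type*} [TopologicalSpace Z]
  [NormedAddCommGroup H] [InnerProductSpace ℂ H] [CompleteSpace H]

/-- A real continuous function, viewed as a complex one. -/
def complexify (f : C(Z, ℝ)) : C(Z, ℂ) := ⟨fun z => (f z : ℂ), by fun_prop⟩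

theorem inner_map_star_mul_self (Φ : C(Z, ℂ) →⋆ₐ[ℂ] (H →L[ℂ] H)) (ξ : H) (F : C(Z, ℂ)) :
    ⟪ξ, Φ (star F * F) ξ⟫_ℂ = ((‖Φ F ξ‖ ^ 2 : ℝ) : ℂ) := by
  rw [map_mul, map_star, mul_apply_eq_comp, ContinuousLinearMap.star_eq_adjoint,
    ContinuousLinearMap.adjoint_inner_right, inner_self_eq_norm_sq_to_K]
  push_cast
  rfl

theorem inner_map_complexify_im (Φ : C(Z, ℂ) →⋆ₐ[ℂ] (H →L[ℂ] H)) (ξ : H) (f : C(Z, ℝ)) :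
    (⟪ξ, Φ (complexify f) ξ⟫_ℂ).im = 0 := by
  have h : star (complexify f) = complexify f := by
    ext z
    simp [complexify]
  rw [← Complex.conj_eq_iff_im, inner_conj_symm, ← ContinuousLinearMap.adjoint_inner_right,
    ← ContinuousLinearMap.star_eq_adjoint, ← map_star, h]

variable [CompactSpace Z]

/-- The positive functional `f ↦ ⟨ξ, Φ(f) ξ⟩` on real continuous functions. -/
noncomputable def vectorFunctional (Φ : C(Z, ℂ) →⋆ₐ[ℂ] (H →L[ℂ] H)) (ξ : H) :
    CompactlySupportedContinuousMap Z ℝ →ₚ[ℝ] ℝ :=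
  PositiveLinearMap.mk₀
    { toFun := fun f => (⟪ξ, Φ (complexify f.toContinuousMap) ξ⟫_ℂ).re
      map_add' := fun f g => by
        have : complexify (f + g).toContinuousMap =
            complexify f.toContinuousMap + complexify g.toContinuousMap := by
          ext z
          simp [complexify]
        rw [this, map_add, add_apply, inner_add_right, Complex.add_re]
      map_smul' := fun c f => by
        have : complexify (c • f).toContinuousMap = (c : ℂ) • complexify f.toContinuousMap := by
          ext z
          simp [complexify]
        rw [this, map_smul, smul_apply, inner_smul_right]
        simp }
    (by
      intro f hf
      have h : complexify f.toContinuousMap =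
          star (complexify ⟨fun z => √(f z), by fun_prop⟩) *
            complexify ⟨fun z => √(f z), by fun_prop⟩ := by
        ext z
        have hz : (0 : ℝ) ≤ f z := hf z
        simp [complexify, ← Complex.ofReal_mul, Real.mul_self_sqrt hz]
      change 0 ≤ (⟪ξ, Φ (complexify f.toContinuousMap) ξ⟫_ℂ).re
      rw [h, inner_map_star_mul_self, Complex.ofReal_re]
      positivity)

variable [MeasurableSpace Z] [BorelSpace Z]

theorem integrable_continuousMap {E : Type*} [NormedAddCommGroup E]
    [SecondCountableTopologyEither Z E] (F : C(Z, E)) (μ : Measure Z) [IsFiniteMeasure μ] :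
    Integrable F μ :=
  F.continuous.integrable_of_hasCompactSupport (HasCompactSupport.of_compactSpace F)

variable [T2Space Z]

/-- The measure on `Z` representing `F ↦ ⟨ξ, Φ(F) ξ⟩`. -/
noncomputable def spectralMeasure (Φ : C(Z, ℂ) →⋆ₐ[ℂ] (H →L[ℂ] H)) (ξ : H) : Measure Z :=
  RealRMK.rieszMeasure (vectorFunctional Φ ξ)

variable (Φ : C(Z, ℂ) →⋆ₐ[ℂ] (H →L[ℂ] H)) (ξ : H)

instance : IsFiniteMeasure (spectralMeasure Φ ξ) := by
  rw [spectralMeasure]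
  infer_instance

theorem integral_spectralMeasure_real (f : C(Z, ℝ)) :
    ∫ z, f z ∂spectralMeasure Φ ξ = (⟪ξ, Φ (complexify f) ξ⟫_ℂ).re :=
  RealRMK.integral_rieszMeasure (vectorFunctional Φ ξ)
    (CompactlySupportedContinuousMap.continuousMapEquiv f)

theorem integral_spectralMeasure (F : C(Z, ℂ)) :
    ∫ z, F z ∂spectralMeasure Φ ξ = ⟪ξ, Φ F ξ⟫_ℂ := by
  let f : C(Z, ℝ) := ⟨fun z => (F z).re, by fun_prop⟩
  let g : C(Z, ℝ) := ⟨fun z => (F z).im, by fun_prop⟩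
  have hF : F = complexify f + Complex.I • complexify g := by
    ext z
    simp [complexify, f, g, mul_comm Complex.I, Complex.re_add_im]
  have h1 : ∀ f : C(Z, ℝ), ∫ z, complexify f z ∂spectralMeasure Φ ξ =
      ⟪ξ, Φ (complexify f) ξ⟫_ℂ := by
    intro f
    have : ∫ z, complexify f z ∂spectralMeasure Φ ξ =
        ((∫ z, f z ∂spectralMeasure Φ ξ : ℝ) : ℂ) := integral_ofReal
    rw [this, integral_spectralMeasure_real]
    apply Complex.ext
    · simp
    · rw [Complex.ofReal_im, inner_map_complexify_im]
  have hi := fun f : C(Z, ℝ) =>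
    integrable_continuousMap (complexify f) (spectralMeasure Φ ξ)
  have hg : Integrable (fun z => Complex.I • complexify g z) (spectralMeasure Φ ξ) :=
    (hi g).smul Complex.I
  conv_lhs => rw [hF]
  conv_rhs => rw [hF]
  simp only [ContinuousMap.add_apply, ContinuousMap.smul_apply]
  rw [integral_add (hi f) hg, integral_smul, h1, h1, map_add, map_smul]
  simp

/-- `∫ |F|² dη_ξ = ‖Φ(F) ξ‖²`. -/
theorem lintegral_enorm_sq_spectralMeasure (F : C(Z, ℂ)) :
    ∫⁻ z, ‖F z‖ₑ ^ 2 ∂spectralMeasure Φ ξ = ENNReal.ofReal (‖Φ F ξ‖ ^ 2) := by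
  let f : C(Z, ℝ) := ⟨fun z => ‖F z‖ ^ 2, by fun_prop⟩
  have hf : complexify f = star F * F := by
    ext z
    simp [complexify, f, Complex.conj_mul']
  have h := integral_spectralMeasure_real Φ ξ f
  rw [hf, inner_map_star_mul_self, Complex.ofReal_re] at h
  rw [← h, ofReal_integral_eq_lintegral_ofReal
    (integrable_continuousMap f _) (ae_of_all _ fun z => sq_nonneg ‖F z‖)]
  refine lintegral_congr fun z => ?_
  simp [f, ENNReal.ofReal_pow]

theorem spectralMeasure_univ : spectralMeasure Φ ξ Set.univ = ENNReal.ofReal (‖ξ‖ ^ 2) := by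
  simpa using lintegral_enorm_sq_spectralMeasure Φ ξ 1

variable [HasOuterApproxClosed Z]

theorem spectralMeasure_add_add_sub (ξ₁ ξ₂ : H) :
    spectralMeasure Φ (ξ₁ + ξ₂) + spectralMeasure Φ (ξ₁ - ξ₂) =
      (2 : ENNReal) • (spectralMeasure Φ ξ₁ + spectralMeasure Φ ξ₂) := by
  have : IsFiniteMeasure
      ((2 : ENNReal) • (spectralMeasure Φ ξ₁ + spectralMeasure Φ ξ₂)) :=
    Measure.smul_finite _ (by simp)
  refine ext_of_forall_integral_eq_of_IsFiniteMeasure fun f => ?_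
  have hi := fun ξ => f.integrable (spectralMeasure Φ ξ)
  have h := fun ξ => integral_spectralMeasure_real Φ ξ f.toContinuousMap
  simp only [BoundedContinuousFunction.coe_toContinuousMap] at h
  rw [integral_add_measure (hi _) (hi _), integral_smul_measure,
    integral_add_measure (hi _) (hi _), h, h, h, h]
  simp only [map_add, map_sub, inner_add_left, inner_add_right, inner_sub_left, inner_sub_right,
    Complex.add_re, Complex.sub_re, smul_eq_mul, ENNReal.toReal_ofNat]
  ring

theorem spectralMeasure_smul (c : ℂ) :
    spectralMeasure Φ (c • ξ) = ENNReal.ofReal (‖c‖ ^ 2) • spectralMeasure Φ ξ := by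
  have : IsFiniteMeasure (ENNReal.ofReal (‖c‖ ^ 2) • spectralMeasure Φ ξ) :=
    Measure.smul_finite _ ENNReal.ofReal_ne_top
  refine ext_of_forall_integral_eq_of_IsFiniteMeasure fun f => ?_
  have h := fun ξ => integral_spectralMeasure_real Φ ξ f.toContinuousMap
  simp only [BoundedContinuousFunction.coe_toContinuousMap] at h
  rw [integral_smul_measure, h, h, map_smul, inner_smul_left, inner_smul_right, ← mul_assoc,
    Complex.conj_mul', ← Complex.ofReal_pow, Complex.re_ofReal_mul,
    ENNReal.toReal_ofReal (by positivity), smul_eq_mul]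

theorem spectralMeasure_add_apply_le (ξ₁ ξ₂ : H) (E : Set Z) :
    spectralMeasure Φ (ξ₁ + ξ₂) E ≤
      2 * (spectralMeasure Φ ξ₁ E + spectralMeasure Φ ξ₂ E) := by
  have h := congrArg (fun μ : Measure Z => μ E) (spectralMeasure_add_add_sub Φ ξ₁ ξ₂)
  simp only [Measure.add_apply, Measure.smul_apply, smul_eq_mul] at h
  exact h ▸ le_self_add

/-- The vectors whose spectral measure does not charge `E`. -/
noncomputable def nullSubmodule (E : Set Z) : Submodule ℂ H where
  carrier := {ξ | spectralMeasure Φ ξ E = 0}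
  zero_mem' := by
    have := spectralMeasure_smul Φ (0 : H) 0
    change spectralMeasure Φ (0 : H) E = 0
    rw [← zero_smul ℂ (0 : H), this]
    simp
  add_mem' := fun {ξ₁ ξ₂} h₁ h₂ => by
    have h := spectralMeasure_add_apply_le Φ ξ₁ ξ₂ E
    rw [show spectralMeasure Φ ξ₁ E = 0 from h₁, show spectralMeasure Φ ξ₂ E = 0 from h₂] at h
    simpa using h
  smul_mem' := fun c ξ h => by
    change spectralMeasure Φ (c • ξ) E = 0
    rw [spectralMeasure_smul, Measure.smul_apply, show spectralMeasure Φ ξ E = 0 from h]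
    simp

theorem mem_nullSubmodule {E : Set Z} {ξ : H} :
    ξ ∈ nullSubmodule Φ E ↔ spectralMeasure Φ ξ E = 0 := Iff.rfl

theorem isClosed_nullSubmodule (E : Set Z) : IsClosed (nullSubmodule Φ E : Set H) := by
  refine isClosed_of_closure_subset fun ξ hξ => ?_
  rw [SetLike.mem_coe, mem_nullSubmodule]
  refine le_antisymm (ENNReal.le_of_forall_pos_le_add fun ε hε _ => ?_) bot_le
  -- A vector `ξ'` of the subspace within `√(ε / 2)` of `ξ` gives `η_ξ(E) ≤ 2 ‖ξ - ξ'‖² ≤ ε`.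
  obtain ⟨ξ', hξ', hd⟩ := Metric.mem_closure_iff.1 hξ (√(ε / 2)) (by positivity)
  have h := spectralMeasure_add_apply_le Φ ξ' (ξ - ξ') E
  rw [add_sub_cancel, show spectralMeasure Φ ξ' E = 0 from hξ', zero_add] at h
  have h2 : spectralMeasure Φ (ξ - ξ') E ≤ ENNReal.ofReal (ε / 2) := by
    refine (measure_mono (Set.subset_univ E)).trans ?_
    rw [spectralMeasure_univ]
    refine ENNReal.ofReal_le_ofReal ?_
    rw [dist_eq_norm] at hd
    exact (Real.le_sqrt (norm_nonneg _) (by positivity)).1 hd.le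
  refine h.trans ((mul_le_mul_right h2 2).trans ?_)
  rw [show (2 : ENNReal) = ENNReal.ofReal 2 by simp, ← ENNReal.ofReal_mul (by norm_num),
    mul_div_cancel₀ _ (two_ne_zero), ENNReal.ofReal_coe_nnreal, zero_add]

end SpectralMeasure

/-! ### Separating sequences of continuous functions -/

section Metrizable

variable {X : Type*} [TopologicalSpace X] [CompactSpace X] [T2Space X] [SeparableSpace C(X, ℂ)]

theorem denseSeq_continuousMap_separates {x y : X}
    (h : ∀ n, denseSeq C(X, ℂ) n x = denseSeq C(X, ℂ) n y) : x = y := by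
  have hall : (fun f : C(X, ℂ) => f x) = fun f => f y :=
    (denseRange_denseSeq C(X, ℂ)).equalizer (continuous_eval_const x)
      (continuous_eval_const y) (funext h)
  by_contra hxy
  obtain ⟨f, hf0, hf1, -⟩ := exists_continuous_zero_one_of_isClosed
    (isClosed_singleton (x := x)) (isClosed_singleton (x := y)) (by simpa using hxy)
  have := congrFun hall (complexify f)
  simp [complexify, hf0 (Set.mem_singleton x), hf1 (Set.mem_singleton y)] at this

variable (X) in
/-- A compact Hausdorff space is metrizable when `C(X)` is separable: a dense sequence in `C(X)`
embeds `X` into a countable power of `ℂ`. -/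
theorem metrizableSpace_of_separableSpace_continuousMap : MetrizableSpace X := by
  have hc : Continuous fun (x : X) (n : ℕ) => denseSeq C(X, ℂ) n x := by fun_prop
  exact (hc.isClosedEmbedding fun x y h =>
    denseSeq_continuousMap_separates (congrFun h)).isEmbedding.metrizableSpace

end Metrizable

/-! ### Measures carried by sets with countable fibres -/

theorem ae_tendsto_of_lintegral_enorm_sub_sq_le {Z : Type*} [MeasurableSpace Z] {μ : Measure Z}
    {f : ℕ → Z → ℂ} {g : Z → ℂ} (hf : ∀ n, Measurable (f n)) (hg : Measurable g)
    (h : ∀ n, ∫⁻ z, ‖g z - f n z‖ₑ ^ 2 ∂μ ≤ 2⁻¹ ^ n) :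
    ∀ᵐ z ∂μ, Filter.Tendsto (fun n => f n z) Filter.atTop (nhds (g z)) := by
  have hm : ∀ n, Measurable fun z => ‖g z - f n z‖ₑ ^ 2 := fun n => by
    have := hf n
    fun_prop
  have hsum : ∫⁻ z, ∑' n, ‖g z - f n z‖ₑ ^ 2 ∂μ ≠ ⊤ := by
    rw [lintegral_tsum fun n => (hm n).aemeasurable]
    refine ne_top_of_le_ne_top ?_ (ENNReal.tsum_le_tsum h)
    rw [ENNReal.tsum_geometric]
    simp
  filter_upwards [ae_lt_top (Measurable.tsum hm) hsum] with z hz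
  have h0 := ENNReal.tendsto_atTop_zero_of_tsum_ne_top hz.ne
  have h1 : Filter.Tendsto (fun n => ‖g z - f n z‖ₑ) Filter.atTop (nhds 0) := by
    have := (ENNReal.continuous_rpow_const (y := (1 / 2 : ℝ))).tendsto 0 |>.comp h0
    rw [ENNReal.zero_rpow_of_pos (by norm_num)] at this
    refine this.congr fun n => ?_
    simp only [Function.comp_apply]
    rw [← ENNReal.rpow_natCast, ← ENNReal.rpow_mul]
    simp
  rw [tendsto_iff_edist_tendsto_0]
  exact h1.congr fun n => by rw [edist_comm, edist_eq_enorm_sub]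

/-- If every continuous function of `p` is an `L²(μ)`-limit of continuous functions of `q`, then
`p` is `μ`-almost everywhere a function of `q`; when `p` and `q` together separate points, `μ` is
carried by a set that meets each fibre of `q` in at most one point. -/
theorem exists_conull_subsingleton_fibres {X Z : Type*} [TopologicalSpace X] [CompactSpace X]
    [T2Space X] [SeparableSpace C(X, ℂ)] [MeasurableSpace X] [BorelSpace X] [MeasurableSpace Z]
    {μ : Measure Z} {p q : Z → X} (hp : Measurable p) (hq : Measurable q)
    (hpq : Function.Injective fun z => (p z, q z))
    (h : ∀ (a : C(X, ℂ)) (ε : ℝ≥0∞), 0 < ε → ∃ b : C(X, ℂ),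
      ∫⁻ z, ‖a (p z) - b (q z)‖ₑ ^ 2 ∂μ ≤ ε) :
    ∃ E : Set Z, μ Eᶜ = 0 ∧ ∀ s, {z ∈ E | q z = s}.Subsingleton := by
  -- Squared errors `2⁻ⁿ` are summable, which turns `L²`-convergence into convergence a.e.
  choose b hb using fun (k n : ℕ) =>
    h (denseSeq C(X, ℂ) k) (2⁻¹ ^ n) (ENNReal.pow_pos (by simp) n)
  refine ⟨{z | ∀ k, Filter.Tendsto (fun n => b k n (q z)) Filter.atTop
    (nhds (denseSeq C(X, ℂ) k (p z)))}, ?_, ?_⟩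
  · have : ∀ᵐ z ∂μ, ∀ k, Filter.Tendsto (fun n => b k n (q z)) Filter.atTop
        (nhds (denseSeq C(X, ℂ) k (p z))) :=
      ae_all_iff.2 fun k => ae_tendsto_of_lintegral_enorm_sub_sq_le
        (fun n => (b k n).continuous.measurable.comp hq)
        ((denseSeq C(X, ℂ) k).continuous.measurable.comp hp) (hb k)
    exact this
  · rintro s z ⟨hz, rfl⟩ w ⟨hw, hwz⟩
    refine hpq (Prod.ext (denseSeq_continuousMap_separates fun k => ?_) hwz.symm)
    exact tendsto_nhds_unique (hz k) (hwz ▸ hw k)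

/-! ### Disintegrations -/

theorem completelyAtomic_of_countable {Z : Type*} [MeasurableSpace Z] {μ : Measure Z} {C : Set Z}
    (hC : C.Countable) (hμ : μ Cᶜ = 0) : CompletelyAtomic μ := by
  refine measure_mono_null (t := (C ∩ {z | μ {z} = 0}) ∪ Cᶜ) (fun z hz => ?_)
    (measure_union_null ?_ hμ)
  · by_cases h : z ∈ C
    · exact Or.inl ⟨h, hz⟩
    · exact Or.inr h
  · rw [← Set.biUnion_of_singleton (C ∩ {z | μ {z} = 0})]
    exact (measure_biUnion_null_iff (hC.mono Set.inter_subset_left)).2 fun z hz => hz.2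

theorem IsDisintegration.ae_completelyAtomic {Z Y : Type*} [MeasurableSpace Z]
    [MeasurableSpace Y] {T : Z → Y} {η : Measure Z} {ν : Measure Y} {lam : Y → Measure Z}
    (h : IsDisintegration T η ν lam) {E : Set Z} (hE : η Eᶜ = 0)
    (hfib : ∀ t, {z ∈ E | T z = t}.Countable) : ∀ᵐ t ∂ν, CompletelyAtomic (lam t) := by
  have hN := measurableSet_toMeasurable η Eᶜ
  -- The null set `Eᶜ` need not be measurable, so its measurable hull is disintegrated.
  have h0 : ∫⁻ t, lam t (toMeasurable η Eᶜ) ∂ν = 0 := by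
    have := h.lintegral_eq ((toMeasurable η Eᶜ).indicator 1) (measurable_one.indicator hN)
    simp only [lintegral_indicator_one hN, measure_toMeasurable, hE] at this
    exact this.symm
  have hm : AEMeasurable (fun t => lam t (toMeasurable η Eᶜ)) ν := by
    have := h.aemeasurable ((toMeasurable η Eᶜ).indicator 1) (measurable_one.indicator hN)
    simpa only [lintegral_indicator_one hN] using this
  filter_upwards [h.concentrated, (lintegral_eq_zero_iff' hm).1 h0] with t h1 h2
  refine completelyAtomic_of_countable (hfib t)
    (measure_mono_null (fun z hz => ?_) (measure_union_null h1 h2))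
  by_cases hzt : T z = t
  · exact Or.inr (subset_toMeasurable _ _ fun hzE => hz ⟨hzE, hzt⟩)
  · exact Or.inl hzt

/-- The fibre measures are the conditional measures of `η` given `T`, weighted by the density of
the law of `T` with respect to `ν`. -/
theorem exists_isDisintegration {Z Y : Type*} [MeasurableSpace Z] [StandardBorelSpace Z]
    [Nonempty Z] [MeasurableSpace Y] [MeasurableEq Y] {T : Z → Y} (hT : Measurable T)
    (η : Measure Z) [IsFiniteMeasure η] (ν : Measure Y) [SigmaFinite ν] (h : η.map T ≪ ν) :
    ∃ lam : Y → Measure Z, IsDisintegration T η ν lam := by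
  -- `ρ` is the joint law of `(T z, z)`.
  set ρ : Measure (Y × Z) := η.map fun z => (T z, z) with hρ
  have hTz : Measurable fun z => (T z, z) := hT.prodMk measurable_id
  have hfst : ρ.fst = η.map T := by
    rw [hρ, Measure.fst, Measure.map_map measurable_fst hTz]
    rfl
  set g := (η.map T).rnDeriv ν with hg
  have hgm : Measurable g := Measure.measurable_rnDeriv _ _
  have hdens : ρ.fst = ν.withDensity g := by
    rw [hfst, hg, Measure.withDensity_rnDeriv_eq _ _ h]
  have hint : ∀ F : Y × Z → ℝ≥0∞, Measurable F →
      ∫⁻ z, F (T z, z) ∂η = ∫⁻ t, g t * ∫⁻ z, F (t, z) ∂ρ.condKernel t ∂ν := by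
    intro F hF
    rw [← lintegral_map hF hTz, ← hρ]
    conv_lhs => rw [← ρ.disintegrate ρ.condKernel]
    rw [Measure.lintegral_compProd hF, hdens, lintegral_withDensity_eq_lintegral_mul _ hgm
      hF.lintegral_kernel_prod_right']
    rfl
  refine ⟨fun t => g t • ρ.condKernel t, ?_, ?_, ?_, ?_⟩
  · filter_upwards [Measure.rnDeriv_lt_top (η.map T) ν] with t ht
    have : IsFiniteMeasure (g t • ρ.condKernel t) := Measure.smul_finite _ ht.ne
    infer_instance
  · have hS : MeasurableSet {x : Y × Z | T x.2 ≠ x.1} :=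
      (measurableSet_eq_fun (hT.comp measurable_snd) measurable_fst).compl
    have h0 := hint ({x : Y × Z | T x.2 ≠ x.1}.indicator 1) (measurable_one.indicator hS)
    have h1 : ∀ t, ∫⁻ z, {x : Y × Z | T x.2 ≠ x.1}.indicator 1 (t, z) ∂ρ.condKernel t =
        ρ.condKernel t {z | T z ≠ t} := fun t =>
      lintegral_indicator_one (μ := ρ.condKernel t) (s := {z | T z ≠ t}) (measurable_prodMk_left hS)
    have h2 : ∀ z, {x : Y × Z | T x.2 ≠ x.1}.indicator (1 : Y × Z → ℝ≥0∞) (T z, z) = 0 :=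
      fun z => Set.indicator_of_notMem
        (fun hz : (T z, z) ∈ {x : Y × Z | T x.2 ≠ x.1} => hz rfl) _
    simp only [h1, h2, lintegral_zero] at h0
    have hm : Measurable fun t => g t * ρ.condKernel t {z | T z ≠ t} :=
      hgm.mul (ProbabilityTheory.Kernel.measurable_kernel_prodMk_left hS)
    filter_upwards [(lintegral_eq_zero_iff hm).1 h0.symm] with t ht
    exact ht
  · intro f hf
    simp only [lintegral_smul_measure]
    exact (hgm.mul hf.lintegral_kernel).aemeasurable
  · intro f hf
    simp only [lintegral_smul_measure]
    exact hint (fun x => f x.2) (hf.comp measurable_snd)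

/-! ### The group of normalisers -/

section Normalizer

variable {M : Type u} [CStarAlgebra M]

theorem star_mem_normalizer {A : StarSubalgebra ℂ M} {u : M} (hu : u ∈ normalizer A) :
    star u ∈ normalizer A := by
  refine ⟨Unitary.star_mem hu.1, ?_⟩
  have h : ∀ a, star u * (u * a * star u) * star (star u) = a := fun a => by
    rw [star_star, mul_assoc u, ← mul_assoc (star u), Unitary.star_mul_self_of_mem hu.1, one_mul,
      mul_assoc, Unitary.star_mul_self_of_mem hu.1, mul_one]
  conv_lhs => rw [← hu.2]
  rw [Set.image_image]
  simp only [h, Set.image_id']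

theorem one_mem_normalizer (A : StarSubalgebra ℂ M) : (1 : M) ∈ normalizer A :=
  ⟨one_mem _, by simp⟩

theorem mul_mem_normalizer {A : StarSubalgebra ℂ M} {u v : M} (hu : u ∈ normalizer A)
    (hv : v ∈ normalizer A) : u * v ∈ normalizer A := by
  refine ⟨mul_mem hu.1 hv.1, ?_⟩
  conv_rhs => rw [← hu.2, ← hv.2, Set.image_image]
  simp only [star_mul, mul_assoc]

theorem conj_mem_of_mem_normalizer {A : StarSubalgebra ℂ M} {u a : M} (hu : u ∈ normalizer A)
    (ha : a ∈ A) : u * a * star u ∈ A := by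
  have : u * a * star u ∈ (fun a => u * a * star u) '' (A : Set M) := ⟨a, ha, rfl⟩
  rwa [hu.2] at this

end Normalizer

/-! ### Left and right multiplication on `L²(M, τ)` -/

section Bimodule

variable {M : Type u} [CStarAlgebra M] [PartialOrder M] [StarOrderedRing M] {τ : M →ₚ[ℂ] ℂ}

theorem continuousLinearMap_ext_hat {S T : τ.GNS →L[ℂ] τ.GNS}
    (h : ∀ x, S (hat τ x) = T (hat τ x)) : S = T :=
  ContinuousLinearMap.ext fun ξ => congrFun
    ((denseRange_hat τ).equalizer S.continuous T.continuous (funext h)) ξ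

theorem star_rightMul (hτ : IsFaithfulNormalTracialState τ) (b : M) :
    star (rightMul τ b) = rightMul τ (star b) := by
  refine continuousLinearMap_ext_hat fun y => (denseRange_hat τ).eq_of_inner_right ℂ fun x => ?_
  rw [ContinuousLinearMap.star_eq_adjoint, ContinuousLinearMap.adjoint_inner_right,
    rightMul_hat hτ, rightMul_hat hτ, inner_hat, inner_hat, star_mul, mul_assoc, hτ.tracial,
    mul_assoc]

theorem commute_gnsStarAlgHom_rightMul (hτ : IsFaithfulNormalTracialState τ) (a b : M) :
    Commute (τ.gnsStarAlgHom a) (rightMul τ b) :=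
  continuousLinearMap_ext_hat fun x => by
    simp only [mul_apply_eq_comp, rightMul_hat hτ, gnsStarAlgHom_hat, mul_assoc]

theorem norm_hat_unitary_mul {u : M} (hu : u ∈ unitary M) (x : M) :
    ‖hat τ (u * x)‖ = ‖hat τ x‖ := by
  have h : ((‖hat τ (u * x)‖ ^ 2 : ℝ) : ℂ) = ((‖hat τ x‖ ^ 2 : ℝ) : ℂ) := by
    rw [norm_hat_sq, norm_hat_sq, star_mul, mul_assoc, ← mul_assoc (star u),
      Unitary.star_mul_self_of_mem hu, one_mul]
  exact (sq_eq_sq₀ (norm_nonneg _) (norm_nonneg _)).1 (by exact_mod_cast h)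

theorem norm_hat_mul_unitary (hτ : IsFaithfulNormalTracialState τ) {u : M} (hu : u ∈ unitary M)
    (x : M) : ‖hat τ (x * u)‖ = ‖hat τ x‖ := by
  have h : ((‖hat τ (x * u)‖ ^ 2 : ℝ) : ℂ) = ((‖hat τ x‖ ^ 2 : ℝ) : ℂ) := by
    rw [norm_hat_sq, norm_hat_sq, hτ.tracial, star_mul, mul_assoc, ← mul_assoc u,
      Unitary.mul_star_self_of_mem hu, one_mul, hτ.tracial]
  exact (sq_eq_sq₀ (norm_nonneg _) (norm_nonneg _)).1 (by exact_mod_cast h)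

/-! ### The closed span of the normalisers -/

/-- `L²(N(A)'')` lies in the closed span of `N(A)`: the projection onto that span commutes with
`N(A)`, hence with `N(A)''`, and it fixes `1`. -/
theorem L2_bicommutant_normalizer_subset (A : StarSubalgebra ℂ M) :
    L2 τ (bicommutant τ (normalizer A)) ⊆
      (Submodule.span ℂ (hat τ '' normalizer A)).topologicalClosure := by
  set K := (Submodule.span ℂ (hat τ '' normalizer A)).topologicalClosure with hK
  have hKc : IsClosed (K : Set τ.GNS) := Submodule.isClosed_topologicalClosure _
  have : CompleteSpace K := hKc.completeSpace_coe
  refine closure_minimal ?_ hKc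
  rintro _ ⟨x, hx, rfl⟩
  have hmaps : ∀ u ∈ normalizer A, ∀ ξ ∈ K, τ.gnsStarAlgHom u ξ ∈ K := by
    intro u hu
    have hle : Submodule.span ℂ (hat τ '' normalizer A) ≤
        K.comap (τ.gnsStarAlgHom u : τ.GNS →ₗ[ℂ] τ.GNS) := by
      refine Submodule.span_le.2 ?_
      rintro _ ⟨v, hv, rfl⟩
      change τ.gnsStarAlgHom u (hat τ v) ∈ K
      rw [gnsStarAlgHom_hat]
      exact Submodule.le_topologicalClosure _
        (Submodule.subset_span ⟨u * v, mul_mem_normalizer hu hv, rfl⟩)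
    exact Submodule.topologicalClosure_minimal _ hle
      (hKc.preimage (τ.gnsStarAlgHom u).continuous)
  have hp : K.starProjection ∈ Set.centralizer (τ.gnsStarAlgHom '' normalizer A) := by
    rintro _ ⟨u, hu, rfl⟩
    ext ξ
    simp only [mul_apply_eq_comp]
    refine (Submodule.eq_starProjection_of_mem_orthogonal (hmaps u hu _
      (Submodule.starProjection_apply_mem K ξ)) ?_).symm
    rw [← map_sub, Submodule.mem_orthogonal']
    intro w hw
    rw [← ContinuousLinearMap.adjoint_inner_right, ← ContinuousLinearMap.star_eq_adjoint,
      ← map_star]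
    exact Submodule.inner_left_of_mem_orthogonal (hmaps _ (star_mem_normalizer hu) w hw)
      (Submodule.sub_starProjection_mem_orthogonal ξ)
  have h1 : hat τ 1 ∈ K := Submodule.le_topologicalClosure _
    (Submodule.subset_span ⟨1, one_mem_normalizer A, rfl⟩)
  have h2 := congrArg (fun T : τ.GNS →L[ℂ] τ.GNS => T (hat τ 1)) (hx _ hp)
  simp only [mul_apply_eq_comp, gnsStarAlgHom_hat, mul_one,
    Submodule.starProjection_eq_self_iff.2 h1] at h2
  rw [SetLike.mem_coe, ← h2]
  exact Submodule.starProjection_apply_mem K _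

/-! ### The representation of `C(X × X)` -/

variable {X : Type v} [TopologicalSpace X] [CompactSpace X]

/-- The right action of `C(X) ⊆ M` on `L²(M, τ)`; it is multiplicative because `C(X)` is
commutative. -/
noncomputable def rightStarAlgHom (hτ : IsFaithfulNormalTracialState τ) (ι : C(X, ℂ) →⋆ₐ[ℂ] M) :
    C(X, ℂ) →⋆ₐ[ℂ] (τ.GNS →L[ℂ] τ.GNS) where
  toFun f := rightMul τ (ι f)
  map_one' := continuousLinearMap_ext_hat fun x => by simp [rightMul_hat hτ]
  map_mul' f g := continuousLinearMap_ext_hat fun x => by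
    rw [mul_comm f g]
    simp only [mul_apply_eq_comp, rightMul_hat hτ, map_mul, mul_assoc]
  map_zero' := continuousLinearMap_ext_hat fun x => by simp [rightMul_hat hτ]
  map_add' f g := continuousLinearMap_ext_hat fun x => by
    simp only [add_apply, rightMul_hat hτ, map_add, mul_add]
  commutes' c := continuousLinearMap_ext_hat fun x => by
    rw [rightMul_hat hτ, AlgHomClass.commutes, ← Algebra.commutes, ← Algebra.smul_def, map_smul]
    rfl
  map_star' f := by rw [star_rightMul hτ, map_star]

/-- `Φ` is the representation `a ⊗ b ↦ (ξ ↦ a ξ b)` of `C(X × X)` on `L²(M, τ)`. -/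
structure IsBimoduleRep (τ : M →ₚ[ℂ] ℂ) (ι : C(X, ℂ) →⋆ₐ[ℂ] M)
    (Φ : C(X × X, ℂ) →⋆ₐ[ℂ] (τ.GNS →L[ℂ] τ.GNS)) : Prop where
  comp_fst : ∀ f : C(X, ℂ), Φ (f.comp .fst) = τ.gnsStarAlgHom (ι f)
  comp_snd : ∀ f : C(X, ℂ), Φ (f.comp .snd) = rightMul τ (ι f)

/-- Weak operator density of `C(X)` in `A` gives `‖·‖₂`-density: a closed subspace is weakly
closed. -/
theorem IsWOTDenseIn.hat_mem_closure {A : StarSubalgebra ℂ M} {ι : C(X, ℂ) →⋆ₐ[ℂ] M}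
    (hι : IsWOTDenseIn τ A ι) {y : M}
    (hy : y ∈ A) : hat τ y ∈ closure (Set.range fun f => hat τ (ι f)) := by
  let K : Submodule ℂ τ.GNS := LinearMap.range ((hat τ).comp (ι : C(X, ℂ) →ₗ[ℂ] M))
  have hK : (K : Set τ.GNS) = Set.range fun f => hat τ (ι f) := LinearMap.coe_range _
  rw [← hK, ← Submodule.topologicalClosure_coe, SetLike.mem_coe,
    ← Submodule.orthogonal_orthogonal_eq_closure, Submodule.mem_orthogonal]
  intro ξ hξ
  let φ : ContinuousLinearMapWOT (RingHom.id ℂ) τ.GNS τ.GNS → ℂ := fun T => ⟪ξ, T (hat τ 1)⟫_ℂ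
  have hφ : Continuous φ :=
    ContinuousLinearMapWOT.continuous_dual_apply (hat τ 1) (innerSL ℂ ξ)
  have hcl : IsClosed {T | φ T = 0} := isClosed_eq hφ continuous_const
  have hsub : closure (Set.range fun f : C(X, ℂ) =>
      ContinuousLinearMapWOT.ofCLM (τ.gnsStarAlgHom (ι f))) ⊆ {T | φ T = 0} := by
    refine closure_minimal ?_ hcl
    rintro _ ⟨f, rfl⟩
    change ⟪ξ, τ.gnsStarAlgHom (ι f) (hat τ 1)⟫_ℂ = 0
    rw [gnsStarAlgHom_hat, mul_one]
    exact Submodule.inner_left_of_mem_orthogonal (K := K) ⟨f, rfl⟩ hξ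
  have h : ⟪ξ, τ.gnsStarAlgHom y (hat τ 1)⟫_ℂ = 0 := hsub (hι.dense y hy)
  rwa [gnsStarAlgHom_hat, mul_one] at h

theorem IsWOTDenseIn.exists_norm_sub_sq_le {A : StarSubalgebra ℂ M} {ι : C(X, ℂ) →⋆ₐ[ℂ] M}
    (hι : IsWOTDenseIn τ A ι)
    {y : M} (hy : y ∈ A) {ε : ℝ≥0∞} (hε : 0 < ε) :
    ∃ b : C(X, ℂ), ENNReal.ofReal (‖hat τ (y - ι b)‖ ^ 2) ≤ ε := by
  have hc : Filter.Tendsto (fun ξ : τ.GNS => ENNReal.ofReal (‖hat τ y - ξ‖ ^ 2))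
      (nhds (hat τ y)) (nhds 0) := by
    have : Continuous fun ξ : τ.GNS => ENNReal.ofReal (‖hat τ y - ξ‖ ^ 2) :=
      ENNReal.continuous_ofReal.comp (by fun_prop)
    simpa using this.tendsto (hat τ y)
  obtain ⟨_, hξ, b, rfl⟩ := mem_closure_iff_nhds.1 (hι.hat_mem_closure hy) _
    (hc.eventually (gt_mem_nhds hε))
  exact ⟨b, by rw [map_sub]; exact le_of_lt hξ⟩

theorem IsBimoduleMeasure.unique [MeasurableSpace X] [BorelSpace X]
    [HasOuterApproxClosed X] {ι : C(X, ℂ) →⋆ₐ[ℂ] M} {ζ : τ.GNS} {η₁ η₂ : Measure (X × X)}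
    (h₁ : IsBimoduleMeasure τ ι ζ η₁) (h₂ : IsBimoduleMeasure τ ι ζ η₂) : η₁ = η₂ := by
  have := h₁.isFiniteMeasure
  have := h₂.isFiniteMeasure
  refine Measure.ext_of_integral_mul_boundedContinuousFunction fun f g => ?_
  have h := (h₁.integral_eq (complexify f.toContinuousMap) (complexify g.toContinuousMap)).trans
    (h₂.integral_eq (complexify f.toContinuousMap) (complexify g.toContinuousMap)).symm
  simp only [complexify, ContinuousMap.coe_mk, BoundedContinuousFunction.coe_toContinuousMap,
    ← Complex.ofReal_mul] at h
  rw [integral_complex_ofReal, integral_complex_ofReal] at h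
  exact_mod_cast h

variable [T2Space X]

theorem exists_isBimoduleRep (hτ : IsFaithfulNormalTracialState τ) (ι : C(X, ℂ) →⋆ₐ[ℂ] M) :
    ∃ Φ, IsBimoduleRep τ ι Φ := by
  obtain ⟨Φ, h1, h2⟩ := exists_starAlgHom_prod_of_commute (τ.gnsStarAlgHom.comp ι)
    (rightStarAlgHom hτ ι) fun f g => commute_gnsStarAlgHom_rightMul hτ (ι f) (ι g)
  exact ⟨Φ, h1, h2⟩

variable [MeasurableSpace X] {ι : C(X, ℂ) →⋆ₐ[ℂ] M}
  {Φ : C(X × X, ℂ) →⋆ₐ[ℂ] (τ.GNS →L[ℂ] τ.GNS)}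

variable [BorelSpace (X × X)]

theorem IsBimoduleRep.isBimoduleMeasure (hΦ : IsBimoduleRep τ ι Φ) (ζ : τ.GNS) :
    IsBimoduleMeasure τ ι ζ (spectralMeasure Φ ζ) where
  isFiniteMeasure := inferInstance
  integral_eq a b := by
    have h := integral_spectralMeasure Φ ζ (a.comp .fst * b.comp .snd)
    rwa [map_mul, hΦ.comp_fst, hΦ.comp_snd] at h

theorem lintegral_enorm_fst_sub_snd_sq (hτ : IsFaithfulNormalTracialState τ)
    (hΦ : IsBimoduleRep τ ι Φ) (x : M) (a b : C(X, ℂ)) :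
    ∫⁻ z, ‖a z.1 - b z.2‖ₑ ^ 2 ∂spectralMeasure Φ (hat τ x) =
      ENNReal.ofReal (‖hat τ (ι a * x - x * ι b)‖ ^ 2) := by
  have h := lintegral_enorm_sq_spectralMeasure Φ (hat τ x) (a.comp .fst - b.comp .snd)
  rw [map_sub, hΦ.comp_fst, hΦ.comp_snd, sub_apply, gnsStarAlgHom_hat,
    rightMul_hat hτ, ← map_sub] at h
  exact h

/-! ### Spectral measures of normalisers -/

variable [BorelSpace X]

theorem map_fst_spectralMeasure_unitary [HasOuterApproxClosed X]
    (hτ : IsFaithfulNormalTracialState τ) (hΦ : IsBimoduleRep τ ι Φ) {ν : Measure X}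
    (hν : IsTracialMeasure τ ι ν) {u : M} (hu : u ∈ unitary M) :
    (spectralMeasure Φ (hat τ u)).map Prod.fst = ν := by
  have := hν.isProbabilityMeasure
  refine ext_of_forall_integral_eq_of_IsFiniteMeasure fun f => ?_
  rw [integral_map measurable_fst.aemeasurable f.continuous.aestronglyMeasurable]
  have h1 := integral_spectralMeasure Φ (hat τ u) ((complexify f.toContinuousMap).comp .fst)
  rw [hΦ.comp_fst, gnsStarAlgHom_hat, inner_hat, hτ.tracial, mul_assoc,
    Unitary.mul_star_self_of_mem hu, mul_one, ← hν.integral_eq] at h1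
  have h2 : ∫ z : X × X, ((f z.1 : ℝ) : ℂ) ∂spectralMeasure Φ (hat τ u) =
      ∫ t, ((f t : ℝ) : ℂ) ∂ν := h1
  rw [integral_complex_ofReal, integral_complex_ofReal] at h2
  exact_mod_cast h2

theorem map_snd_spectralMeasure_unitary [HasOuterApproxClosed X]
    (hτ : IsFaithfulNormalTracialState τ) (hΦ : IsBimoduleRep τ ι Φ) {ν : Measure X}
    (hν : IsTracialMeasure τ ι ν) {u : M} (hu : u ∈ unitary M) :
    (spectralMeasure Φ (hat τ u)).map Prod.snd = ν := by
  have := hν.isProbabilityMeasure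
  refine ext_of_forall_integral_eq_of_IsFiniteMeasure fun f => ?_
  rw [integral_map measurable_snd.aemeasurable f.continuous.aestronglyMeasurable]
  have h1 := integral_spectralMeasure Φ (hat τ u) ((complexify f.toContinuousMap).comp .snd)
  rw [hΦ.comp_snd, rightMul_hat hτ, inner_hat, ← mul_assoc,
    Unitary.star_mul_self_of_mem hu, one_mul, ← hν.integral_eq] at h1
  have h2 : ∫ z : X × X, ((f z.2 : ℝ) : ℂ) ∂spectralMeasure Φ (hat τ u) =
      ∫ t, ((f t : ℝ) : ℂ) ∂ν := h1
  rw [integral_complex_ofReal, integral_complex_ofReal] at h2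
  exact_mod_cast h2

/-- The spectral measure of a normaliser `u` is carried by the graph of the transformation of `X`
that implements `Ad u` on `A`: `a(t)` is an `L²`-limit of functions `b(s)`, since
`‖a u - u b‖₂ = ‖u⋆ a u - b‖₂` and `u⋆ a u` lies in `A`. -/
theorem exists_conull_subsingleton_fibres_snd [SeparableSpace C(X, ℂ)]
    (hτ : IsFaithfulNormalTracialState τ) {A : StarSubalgebra ℂ M} (hι : IsWOTDenseIn τ A ι)
    (hΦ : IsBimoduleRep τ ι Φ) {u : M} (hu : u ∈ normalizer A) :
    ∃ E : Set (X × X), spectralMeasure Φ (hat τ u) Eᶜ = 0 ∧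
      ∀ s, {z ∈ E | z.2 = s}.Subsingleton := by
  refine exists_conull_subsingleton_fibres measurable_fst measurable_snd (fun z w h => h)
    fun a ε hε => ?_
  have hmem : star u * ι a * u ∈ A := by
    simpa using conj_mem_of_mem_normalizer (star_mem_normalizer hu) (hι.mem a)
  obtain ⟨b, hb⟩ := hι.exists_norm_sub_sq_le hmem hε
  refine ⟨b, ?_⟩
  have h : star u * (ι a * u - u * ι b) = star u * ι a * u - ι b := by
    rw [mul_sub, ← mul_assoc, ← mul_assoc (star u) u, Unitary.star_mul_self_of_mem hu.1, one_mul]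
  rwa [lintegral_enorm_fst_sub_snd_sq hτ hΦ, ← norm_hat_unitary_mul (Unitary.star_mem hu.1), h]

/-- The counterpart over the first coordinate: `‖a u - u b‖₂ = ‖a - u b u⋆‖₂` and `u b u⋆` lies
in `A`. -/
theorem exists_conull_subsingleton_fibres_fst [SeparableSpace C(X, ℂ)]
    (hτ : IsFaithfulNormalTracialState τ) {A : StarSubalgebra ℂ M} (hι : IsWOTDenseIn τ A ι)
    (hΦ : IsBimoduleRep τ ι Φ) {u : M} (hu : u ∈ normalizer A) :
    ∃ E : Set (X × X), spectralMeasure Φ (hat τ u) Eᶜ = 0 ∧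
      ∀ t, {z ∈ E | z.1 = t}.Subsingleton := by
  refine exists_conull_subsingleton_fibres measurable_snd measurable_fst
    (fun z w h => Prod.swap_injective h) fun b ε hε => ?_
  obtain ⟨a, ha⟩ := hι.exists_norm_sub_sq_le (conj_mem_of_mem_normalizer hu (hι.mem b)) hε
  refine ⟨a, ?_⟩
  have h : (ι a * u - u * ι b) * star u = -(u * ι b * star u - ι a) := by
    rw [sub_mul, mul_assoc (ι a), Unitary.mul_star_self_of_mem hu.1, mul_one, neg_sub]
  have hsymm : ∀ z : X × X, ‖b z.2 - a z.1‖ₑ = ‖a z.1 - b z.2‖ₑ := fun z => enorm_sub_rev _ _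
  simp only [hsymm]
  rwa [lintegral_enorm_fst_sub_snd_sq hτ hΦ, ← norm_hat_mul_unitary hτ (Unitary.star_mem hu.1), h,
    map_neg, norm_neg]

end Bimodule

/-! ### Passing to the closed span -/

theorem exists_countable_mem_topologicalClosure_span {H : Type*} [NormedAddCommGroup H]
    [NormedSpace ℂ H] {S : Set H} {ξ : H} (h : ξ ∈ (Submodule.span ℂ S).topologicalClosure) :
    ∃ C ⊆ S, C.Countable ∧ ξ ∈ (Submodule.span ℂ C).topologicalClosure := by
  obtain ⟨x, hx, hlim⟩ := mem_closure_iff_seq_limit.1 h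
  choose C hCS hC using fun n => Submodule.mem_span_finite_of_mem_span (hx n)
  refine ⟨⋃ n, (C n : Set H), Set.iUnion_subset hCS,
    Set.countable_iUnion fun n => (C n).countable_toSet, ?_⟩
  exact mem_closure_iff_seq_limit.2 ⟨x, fun n =>
    Submodule.span_mono (Set.subset_iUnion (fun n => (C n : Set H)) n) (hC n), hlim⟩

/-- If the spectral measures of the vectors of `S` are each carried by a set meeting the fibres of
`T` in at most one point, those of the vectors in the closed span of `S` are carried by countable
unions of such sets. -/
theorem exists_conull_countable_fibres {Z Y H : Type*} [TopologicalSpace Z] [CompactSpace Z]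
    [T2Space Z] [MeasurableSpace Z] [BorelSpace Z] [HasOuterApproxClosed Z]
    [NormedAddCommGroup H] [InnerProductSpace ℂ H] [CompleteSpace H]
    (Φ : C(Z, ℂ) →⋆ₐ[ℂ] (H →L[ℂ] H)) (T : Z → Y) {S : Set H}
    (hS : ∀ ξ ∈ S, ∃ E : Set Z, spectralMeasure Φ ξ Eᶜ = 0 ∧
      ∀ t, {z ∈ E | T z = t}.Subsingleton)
    {ζ : H} (hζ : ζ ∈ (Submodule.span ℂ S).topologicalClosure) :
    ∃ E : Set Z, spectralMeasure Φ ζ Eᶜ = 0 ∧ ∀ t, {z ∈ E | T z = t}.Countable := by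
  obtain ⟨C, hCS, hC, hζC⟩ := exists_countable_mem_topologicalClosure_span hζ
  choose! E hE hfib using hS
  refine ⟨⋃ ξ ∈ C, E ξ, ?_, fun t => ?_⟩
  · rw [← mem_nullSubmodule]
    refine Submodule.topologicalClosure_minimal _ (Submodule.span_le.2 fun ξ hξ => ?_)
      (isClosed_nullSubmodule Φ _) hζC
    exact measure_mono_null (Set.compl_subset_compl.2 (Set.subset_biUnion_of_mem hξ))
      (hE ξ (hCS hξ))
  · refine (hC.biUnion fun ξ hξ => (hfib ξ (hCS hξ) t).countable).mono ?_
    rintro z ⟨hz, hzt⟩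
    obtain ⟨ξ, hξ, hzξ⟩ := Set.mem_iUnion₂.1 hz
    exact Set.mem_biUnion hξ ⟨hzξ, hzt⟩

theorem map_spectralMeasure_absolutelyContinuous {Z Y H : Type*} [TopologicalSpace Z]
    [CompactSpace Z] [T2Space Z] [MeasurableSpace Z] [BorelSpace Z] [HasOuterApproxClosed Z]
    [MeasurableSpace Y] [NormedAddCommGroup H] [InnerProductSpace ℂ H] [CompleteSpace H]
    (Φ : C(Z, ℂ) →⋆ₐ[ℂ] (H →L[ℂ] H)) {T : Z → Y} (hT : Measurable T) {ν : Measure Y} {S : Set H}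
    (hS : ∀ ξ ∈ S, (spectralMeasure Φ ξ).map T = ν)
    {ζ : H} (hζ : ζ ∈ (Submodule.span ℂ S).topologicalClosure) :
    (spectralMeasure Φ ζ).map T ≪ ν := by
  refine Measure.AbsolutelyContinuous.mk fun N hN hN0 => ?_
  rw [Measure.map_apply hT hN, ← mem_nullSubmodule]
  refine Submodule.topologicalClosure_minimal _ (Submodule.span_le.2 fun ξ hξ => ?_)
    (isClosed_nullSubmodule Φ _) hζ
  rw [SetLike.mem_coe, mem_nullSubmodule, ← Measure.map_apply hT hN, hS ξ hξ, hN0]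

end MasaBimodule

theorem mainTheorem12
    {M : Type*} [CStarAlgebra M] [PartialOrder M] [StarOrderedRing M]
    (hM : MasaBimodule.IsSeparableTypeII1Factor M)
    (τ : M →ₚ[ℂ] ℂ) (hτ : MasaBimodule.IsFaithfulNormalTracialState τ)
    (A : StarSubalgebra ℂ M) (hA : MasaBimodule.IsMasa A)
    {X : Type*} [TopologicalSpace X] [CompactSpace X] [T2Space X]
    [TopologicalSpace.SeparableSpace C(X, ℂ)] [MeasurableSpace X] [BorelSpace X]
    (ι : C(X, ℂ) →⋆ₐ[ℂ] M) (hι : MasaBimodule.IsWOTDenseIn τ A ι)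
    (ν : MeasureTheory.Measure X) (hν : MasaBimodule.IsTracialMeasure τ ι ν)
    (ζ : τ.GNS) (hζ0 : ζ ≠ 0)
    (hζ : ζ ∈ MasaBimodule.L2 τ (MasaBimodule.bicommutant τ (MasaBimodule.normalizer A))) :
    (∃! η : MeasureTheory.Measure (X × X), MasaBimodule.IsBimoduleMeasure τ ι ζ η) ∧
    ∀ η : MeasureTheory.Measure (X × X), MasaBimodule.IsBimoduleMeasure τ ι ζ η →
      ((∃ lam : X → MeasureTheory.Measure (X × X),
          MasaBimodule.IsDisintegration Prod.fst η ν lam) ∧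
        ∀ lam : X → MeasureTheory.Measure (X × X),
          MasaBimodule.IsDisintegration Prod.fst η ν lam →
            ∀ᵐ t ∂ν, MasaBimodule.CompletelyAtomic (lam t)) ∧
      ((∃ lam : X → MeasureTheory.Measure (X × X),
          MasaBimodule.IsDisintegration Prod.snd η ν lam) ∧
        ∀ lam : X → MeasureTheory.Measure (X × X),
          MasaBimodule.IsDisintegration Prod.snd η ν lam →
            ∀ᵐ s ∂ν, MasaBimodule.CompletelyAtomic (lam s)) := by
  have hX := MasaBimodule.metrizableSpace_of_separableSpace_continuousMap X
  let _ : MetricSpace X := TopologicalSpace.metrizableSpaceMetric X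
  have hνp := hν.isProbabilityMeasure
  have hne : Nonempty X := nonempty_of_isProbabilityMeasure ν
  obtain ⟨Φ, hΦ⟩ := MasaBimodule.exists_isBimoduleRep hτ ι
  have hmeas := hΦ.isBimoduleMeasure ζ
  have hK := MasaBimodule.L2_bicommutant_normalizer_subset A hζ
  refine ⟨⟨_, hmeas, fun η hη => hη.unique hmeas⟩, fun η hη => ?_⟩
  obtain rfl := hη.unique hmeas
  refine ⟨⟨?_, fun lam hlam => ?_⟩, ⟨?_, fun lam hlam => ?_⟩⟩
  · refine MasaBimodule.exists_isDisintegration measurable_fst _ ν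
      (MasaBimodule.map_spectralMeasure_absolutelyContinuous Φ measurable_fst ?_ hK)
    rintro _ ⟨u, hu, rfl⟩
    exact MasaBimodule.map_fst_spectralMeasure_unitary hτ hΦ hν hu.1
  · obtain ⟨E, hE, hfib⟩ := MasaBimodule.exists_conull_countable_fibres Φ Prod.fst (by
      rintro _ ⟨u, hu, rfl⟩
      exact MasaBimodule.exists_conull_subsingleton_fibres_fst hτ hι hΦ hu) hK
    exact hlam.ae_completelyAtomic hE hfib
  · refine MasaBimodule.exists_isDisintegration measurable_snd _ ν
      (MasaBimodule.map_spectralMeasure_absolutelyContinuous Φ measurable_snd ?_ hK)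
    rintro _ ⟨u, hu, rfl⟩
    exact MasaBimodule.map_snd_spectralMeasure_unitary hτ hΦ hν hu.1
  · obtain ⟨E, hE, hfib⟩ := MasaBimodule.exists_conull_countable_fibres Φ Prod.snd (by
      rintro _ ⟨u, hu, rfl⟩
      exact MasaBimodule.exists_conull_subsingleton_fibres_snd hτ hι hΦ hu) hK
    exact hlam.ae_completelyAtomic hE hfib
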